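/- Let $d\ge 1$ and let $\mathbb S^{d-1}\subset\mathbb R^d$ be the Euclidean unit sphere. On a probability space $(\Omega,\mathcal F,\mathbb P)$ let $R\ge 0$ be a random variable and $\mathbf U$ a random vector with values in $\mathbb S^{d-1}$, and assume the following. (A1) $-\log\mathbb P(R>x)\sim h(x)$ as $x\to\infty$, where $h:\mathbb R\to\mathbb R$ is increasing and concave on some half-line $[x_0,\infty)$, $h(x)=o(x)$ and $\log x=o(h(x))$ as $x\to\infty$. (A2) For every Borel set $S\subset\mathbb S^{d-1}$ of positive Lebesgue surface measure, $\mathbb P(\mathbf U\in S)>0$ and $\lim_{x\to\infty}\mathbb P(\mathbf U\in S\mid R>x)=\mathbb P(\mathbf U\in S)$; moreover $\mathbb E(R\mathbf U)=\mathbf 0$. Assume also that for every $a>0$ the limit $\lim_{x\to\infty}h(ax)/h(x)$ exists in $\mathbb R$. Let $\mathbf X_1,\mathbf X_2,\dots$ be i.i.d. random vectors with the law of $R\mathbf U$, let $\mathbf S_n=\mathbf X_1+\dots+\mathbf X_n$, and put $$I(\mathbf 0)=0,\qquad I(\mathbf x)=\lim_{n\to\infty}\frac{h(n\|\mathbf x\|_2)}{h(n)}\quad(\mathbf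 x\ne\mathbf 0).$$ Suppose that $I$ is continuous on $\mathbb R^d$ and that $B\subset\mathbb R^d$ is a Borel set with $\overline{B^\circ}=\overline B$. Then $$\lim_{n\to\infty}\frac{\log\mathbb P(\mathbf S_n\in nB)}{h(n)}=-\inf_{\mathbf x\in B}I(\mathbf x),$$ where the limit is taken in $[-\infty,\infty]$ with the conventions $\log 0=-\infty$ and $\inf\emptyset=+\infty$. -/

import Mathlib

open MeasureTheory ProbabilityTheory Filter Topology Asymptotics
open scoped Pointwise

/-- Tail assumption on the radius `R ≥ 0`: `-log P(R > x) ~ h(x)` as `x → ∞`, where `h` is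
increasing and concave (on some half-line `[x₀, ∞)`), `h(x) = o(x)` and `log x = o(h(x))`. -/
structure RadialTailAssumption {Ω : Type*} [MeasurableSpace Ω] (P : Measure Ω)
    (R : Ω → ℝ) (h : ℝ → ℝ) : Prop where
  measurable : Measurable R
  nonneg : ∀ᵐ ω ∂P, 0 ≤ R ω
  increasing_concave : ∃ x₀ : ℝ, MonotoneOn h (Set.Ici x₀) ∧ ConcaveOn ℝ (Set.Ici x₀) h
  isLittleO_id : h =o[atTop] (fun x : ℝ => x)
  log_isLittleO : Real.log =o[atTop] h
  tail : (fun x : ℝ => -Real.log (P.real {ω | x < R ω})) ~[atTop] h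

/-- Assumption on the direction `U`, a random element of the unit sphere of `ℝ^d`. The measure
`volume.toSphere` is the (unnormalised) Lebesgue surface measure of the sphere; for `d = 1` it is
the counting measure on `{-1, 1}`. `P[A | C]` is the elementary conditional probability. -/
structure DirectionAssumption {Ω : Type*} [MeasurableSpace Ω] (P : Measure Ω) {d : ℕ}
    (R : Ω → ℝ) (U : Ω → Metric.sphere (0 : EuclideanSpace ℝ (Fin d)) 1) : Prop where
  measurable : Measurable U
  pos : ∀ S : Set (Metric.sphere (0 : EuclideanSpace ℝ (Fin d)) 1), MeasurableSet S →
    0 < (volume : Measure (EuclideanSpace ℝ (Fin d))).toSphere S → 0 < P (U ⁻¹' S)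
  asymptotically_indep : ∀ S : Set (Metric.sphere (0 : EuclideanSpace ℝ (Fin d)) 1),
    MeasurableSet S → 0 < (volume : Measure (EuclideanSpace ℝ (Fin d))).toSphere S →
    Tendsto (fun x : ℝ => P[U ⁻¹' S | {ω | x < R ω}]) atTop (𝓝 (P (U ⁻¹' S)))
  mean_zero : ∫ ω, R ω • (U ω : EuclideanSpace ℝ (Fin d)) ∂P = 0

/-- The rate function `I(0) = 0`, `I(x) = lim_{n → ∞} h(n ‖x‖) / h(n)` for `x ≠ 0`. -/
noncomputable def rateFunction {d : ℕ} (h : ℝ → ℝ) (x : EuclideanSpace ℝ (Fin d)) : ℝ :=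
  open Classical in
  if x = 0 then 0 else limUnder atTop (fun n : ℕ => h (n * ‖x‖) / h n)

/-- The random walk `S_n = X_1 + ⋯ + X_n`; the increments are indexed from `0`. -/
def randomWalk {Ω : Type*} {d : ℕ} (X : ℕ → Ω → EuclideanSpace ℝ (Fin d)) (n : ℕ) (ω : Ω) :
    EuclideanSpace ℝ (Fin d) :=
  ∑ i ∈ Finset.range n, X i ω

/-! A linear displacement of a walk with such stretched-exponential-like tails is produced most
cheaply by one increment. Writing `l a` for the limit of `h (a * x) / h x`, the rate of `x ≠ 0` is
`l ‖x‖`, and `l` is multiplicative and monotone.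

Lower bound: near an interior point `x₀ ≠ 0` of `B`, the last increment lies near `n • x₀` and the
other increments sum to `o(n)` by the law of large numbers. The jump costs `l ‖x₀‖ * h n`:
asymptotic independence supplies the direction, and `l a < l b` for `a < b` keeps the radius from
overshooting.

Upper bound: `B` lies outside the open ball of radius `r = dist(0, B)`, so only the event that the
norm of the walk is at least `r * n` matters. A finite net of directions reduces it to centred real
sums. With `x = s * n`, either some increment exceeds `x`, which a union bound controls, or the
increments may be truncated at `x` and the Chernoff bound applies with tilt `(1 - ε) * h x / x`.
Concavity of `h` keeps the tilted second moments bounded uniformly in `x`; hence the log-mgf is of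
the order of the squared tilt, and `n` times that is `o(h x)` because `h x = o(x)`. -/

namespace RadialTailAssumption

/-! ### Growth and concavity of `h`. -/

variable {Ω : Type*} [MeasurableSpace Ω] {P : Measure Ω} {R : Ω → ℝ} {h : ℝ → ℝ}

/-- Domination of `log` only gives `|h| → ∞`; monotonicity excludes the limit `-∞`. -/
theorem tendsto_atTop (hR : RadialTailAssumption P R h) : Tendsto h atTop atTop := by
  obtain ⟨x₀, hm, -⟩ := hR.increasing_concave
  have h1 : Tendsto (fun x => |h x|) atTop atTop := by
    have h2 := hR.log_isLittleO.bound one_pos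
    refine tendsto_atTop_mono' _ ?_ Real.tendsto_log_atTop
    filter_upwards [h2] with x hx
    simp only [Real.norm_eq_abs, one_mul] at hx
    exact (le_abs_self _).trans hx
  refine tendsto_atTop_mono' _ ?_ h1
  filter_upwards [eventually_ge_atTop x₀, h1.eventually_gt_atTop |h x₀|] with x hx hx1
  have h3 : h x₀ ≤ h x := hm (Set.self_mem_Ici) hx hx
  rcases abs_cases (h x) with h4 | h4 <;> rcases abs_cases (h x₀) with h5 | h5 <;> linarith

theorem eventually_mul_log_le (hR : RadialTailAssumption P R h) {c : ℝ} (hc : 0 < c) :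
    ∀ᶠ x in atTop, c * Real.log x ≤ h x := by
  filter_upwards [hR.log_isLittleO.bound (inv_pos.2 hc), hR.tendsto_atTop.eventually_ge_atTop 0]
    with x hx h0
  rw [Real.norm_eq_abs, Real.norm_eq_abs, abs_of_nonneg h0, ← div_eq_inv_mul, le_div_iff₀ hc] at hx
  nlinarith [le_abs_self (Real.log x)]

theorem tendsto_div_id (hR : RadialTailAssumption P R h) :
    Tendsto (fun x => h x / x) atTop (𝓝 0) :=
  hR.isLittleO_id.tendsto_div_nhds_zero

theorem tail_bounds [IsProbabilityMeasure P] (hR : RadialTailAssumption P R h) {ε : ℝ}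
    (hε : 0 < ε) :
    ∀ᶠ y in atTop, Real.exp (-((1 + ε) * h y)) ≤ P.real {ω | y < R ω} ∧
      P.real {ω | y < R ω} ≤ Real.exp (-((1 - ε) * h y)) := by
  -- The cap `1 / 2` serves only to show that the tail is positive: a zero tail has `Real.log 0 =
  -- 0`, hence relative error `1`.
  filter_upwards [hR.tail.isLittleO.bound (lt_min hε (show (0 : ℝ) < 1 / 2 by norm_num)),
    hR.tendsto_atTop.eventually_gt_atTop 0] with y hy h0
  simp only [Pi.sub_apply, Real.norm_eq_abs, abs_of_pos h0] at hy
  have hy1 : |-Real.log (P.real {ω | y < R ω}) - h y| ≤ ε * h y :=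
    hy.trans (mul_le_mul_of_nonneg_right (min_le_left _ _) h0.le)
  have hy2 : |-Real.log (P.real {ω | y < R ω}) - h y| ≤ 1 / 2 * h y :=
    hy.trans (mul_le_mul_of_nonneg_right (min_le_right _ _) h0.le)
  have hpos : 0 < P.real {ω | y < R ω} := by
    refine lt_of_le_of_ne measureReal_nonneg fun h1 => ?_
    rw [← h1, Real.log_zero, abs_le] at hy2
    linarith [hy2.1]
  rw [abs_le] at hy1
  rw [← Real.le_log_iff_exp_le hpos, ← Real.log_le_iff_le_exp hpos]
  constructor <;> linarith [hy1.1, hy1.2]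

/-- A substitute for "`h x / x` decreases", since `h` is not controlled near `0`. The chord from a
fixed `z` with `h z ≥ 0` to `x` lies below `h`, so `h y ≥ (y - z) / x * h x`; once `y ≥ K`,
replacing `y - z` by `y` costs at most a factor `1 + δ`. -/
theorem div_mul_le (hR : RadialTailAssumption P R h) {δ : ℝ} (hδ : 0 < δ) :
    ∃ K : ℝ, 0 < K ∧ ∀ y x, K ≤ y → y ≤ x → h x / x * y ≤ (1 + δ) * h y := by
  obtain ⟨x₀, -, hc⟩ := hR.increasing_concave
  obtain ⟨A, hA⟩ := eventually_atTop.1 (hR.tendsto_atTop.eventually_ge_atTop 0)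
  set z := max (max x₀ A) 1 with hz
  have hz1 : 1 ≤ z := le_max_right _ _
  have hzA : A ≤ z := (le_max_right _ _).trans (le_max_left _ _)
  have hzx : x₀ ≤ z := (le_max_left _ _).trans (le_max_left _ _)
  refine ⟨z * (1 + δ) / δ, by positivity, fun y x hy hyx => ?_⟩
  rw [div_le_iff₀ hδ] at hy
  have hzy : z < y := by nlinarith
  have hx0 : 0 < x := by linarith
  have hxz : x - z ≠ 0 := by linarith
  have ha : 0 ≤ (x - y) / (x - z) := div_nonneg (by linarith) (by linarith)
  have hb : 0 ≤ (y - z) / (x - z) := div_nonneg (by linarith) (by linarith)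
  have hab : (x - y) / (x - z) + (y - z) / (x - z) = 1 := by field_simp; ring
  have h1 := hc.2 (show z ∈ Set.Ici x₀ from hzx) (show x ∈ Set.Ici x₀ by
    rw [Set.mem_Ici]; linarith) ha hb hab
  have h2 : (x - y) / (x - z) * z + (y - z) / (x - z) * x = y := by
    field_simp; ring
  simp only [smul_eq_mul] at h1
  rw [h2] at h1
  have h3 : 0 ≤ (x - y) / (x - z) * h z :=
    mul_nonneg (div_nonneg (by linarith) (by linarith)) (hA z hzA)
  have hhx : 0 ≤ h x := hA x (by linarith)
  have h4 : (y - z) / x ≤ (y - z) / (x - z) :=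
    div_le_div_of_nonneg_left (by linarith) (by linarith) (by linarith)
  have h5 : (y - z) / x * h x ≤ h y :=
    (mul_le_mul_of_nonneg_right h4 hhx).trans (by linarith)
  have h6 : y ≤ (1 + δ) * (y - z) := by nlinarith
  calc h x / x * y ≤ h x / x * ((1 + δ) * (y - z)) :=
        mul_le_mul_of_nonneg_left h6 (by positivity)
    _ = (1 + δ) * ((y - z) / x * h x) := by field_simp
    _ ≤ _ := mul_le_mul_of_nonneg_left h5 (by positivity)

/-! ### The multiplicative limit function `l`. -/

variable {l : ℝ → ℝ}

theorem limit_mono (hR : RadialTailAssumption P R h)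
    (hl : ∀ a, 0 < a → Tendsto (fun x : ℝ => h (a * x) / h x) atTop (𝓝 (l a)))
    {a b : ℝ} (ha : 0 < a) (hab : a ≤ b) : l a ≤ l b := by
  obtain ⟨x₀, hm, -⟩ := hR.increasing_concave
  refine le_of_tendsto_of_tendsto (hl a ha) (hl b (ha.trans_le hab)) ?_
  filter_upwards [hR.tendsto_atTop.eventually_gt_atTop 0, eventually_ge_atTop 0,
    (tendsto_id.const_mul_atTop ha).eventually_ge_atTop x₀] with x h0 hx hx1
  have h2 : a * x ≤ b * x := mul_le_mul_of_nonneg_right hab hx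
  exact div_le_div_of_nonneg_right (hm hx1 (le_trans hx1 h2) h2) h0.le

theorem limit_mul (hR : RadialTailAssumption P R h)
    (hl : ∀ a, 0 < a → Tendsto (fun x : ℝ => h (a * x) / h x) atTop (𝓝 (l a)))
    {a b : ℝ} (ha : 0 < a) (hb : 0 < b) : l (a * b) = l a * l b := by
  have ht : Tendsto (fun x : ℝ => b * x) atTop atTop := tendsto_id.const_mul_atTop hb
  refine tendsto_nhds_unique (hl _ (mul_pos ha hb)) ((((hl a ha).comp ht).mul (hl b hb)).congr' ?_)
  filter_upwards [(hR.tendsto_atTop.comp ht).eventually_gt_atTop 0] with x hx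
  simp only [Function.comp_apply] at hx ⊢
  rw [mul_assoc, div_mul_div_cancel₀ hx.ne']

theorem limit_one (hR : RadialTailAssumption P R h)
    (hl : ∀ a, 0 < a → Tendsto (fun x : ℝ => h (a * x) / h x) atTop (𝓝 (l a))) : l 1 = 1 := by
  refine tendsto_nhds_unique (hl 1 one_pos) (tendsto_const_nhds.congr' ?_)
  filter_upwards [hR.tendsto_atTop.eventually_gt_atTop 0] with x hx
  rw [one_mul, div_self hx.ne']

theorem limit_pos (hR : RadialTailAssumption P R h)
    (hl : ∀ a, 0 < a → Tendsto (fun x : ℝ => h (a * x) / h x) atTop (𝓝 (l a)))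
    {a : ℝ} (ha : 0 < a) : 0 < l a := by
  have h1 : l a * l a⁻¹ = 1 := by
    rw [← hR.limit_mul hl ha (inv_pos.2 ha), mul_inv_cancel₀ ha.ne', hR.limit_one hl]
  have h2 : 0 ≤ l a := by
    refine ge_of_tendsto (hl a ha) ?_
    filter_upwards [hR.tendsto_atTop.eventually_gt_atTop 0,
      (hR.tendsto_atTop.comp (tendsto_id.const_mul_atTop ha)).eventually_gt_atTop 0] with x hx hx2
    exact div_nonneg hx2.le hx.le
  refine lt_of_le_of_ne h2 fun h3 => ?_
  rw [← h3, zero_mul] at h1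
  exact zero_ne_one h1

/-- If `l a = l b`, multiplicativity makes `l` equal to `1` at every power of `a / b`; these powers
tend to `0`, where `l` vanishes. -/
theorem limit_strictMono (hR : RadialTailAssumption P R h)
    (hl : ∀ a, 0 < a → Tendsto (fun x : ℝ => h (a * x) / h x) atTop (𝓝 (l a)))
    (hl0 : Tendsto l (𝓝[>] 0) (𝓝 0)) {a b : ℝ} (ha : 0 < a) (hab : a < b) : l a < l b := by
  refine lt_of_le_of_ne (hR.limit_mono hl ha hab.le) fun heq => ?_
  have hb := ha.trans hab
  have hq : 0 < a / b := div_pos ha hb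
  have h1 : l (a / b) = 1 := by
    have h2 : l a = l (a / b) * l b := by rw [← hR.limit_mul hl hq hb, div_mul_cancel₀ _ hb.ne']
    have h3 := hR.limit_pos hl hb
    rw [heq] at h2
    exact mul_right_cancel₀ h3.ne' (by rw [← h2, one_mul])
  have h4 : ∀ k : ℕ, l ((a / b) ^ k) = 1 := by
    intro k
    induction k with
    | zero => rw [pow_zero, hR.limit_one hl]
    | succ k ih => rw [pow_succ, hR.limit_mul hl (pow_pos hq k) hq, ih, h1, one_mul]
  have h5 : Tendsto (fun k : ℕ => (a / b) ^ k) atTop (𝓝[>] 0) :=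
    tendsto_nhdsWithin_iff.2 ⟨tendsto_pow_atTop_nhds_zero_of_lt_one hq.le ((div_lt_one hb).2 hab),
      Eventually.of_forall fun k => pow_pos hq k⟩
  have h6 := hl0.comp h5
  simp only [Function.comp_def, h4] at h6
  exact zero_ne_one (tendsto_nhds_unique h6 tendsto_const_nhds)

end RadialTailAssumption

/-! ### The rate function in terms of `l`. -/

section rateFunction

variable {d : ℕ} {h l : ℝ → ℝ}

theorem rateFunction_zero : rateFunction h (0 : EuclideanSpace ℝ (Fin d)) = 0 := by
  simp [rateFunction]

theorem rateFunction_eq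
    (hl : ∀ a, 0 < a → Tendsto (fun x : ℝ => h (a * x) / h x) atTop (𝓝 (l a)))
    {x : EuclideanSpace ℝ (Fin d)} (hx : x ≠ 0) : rateFunction h x = l ‖x‖ := by
  rw [rateFunction, if_neg hx]
  refine Tendsto.limUnder_eq ?_
  have h1 := (hl _ (norm_pos_iff.2 hx)).comp tendsto_natCast_atTop_atTop
  refine h1.congr fun n => ?_
  simp only [Function.comp_apply, mul_comm]

/-- Along the ray spanned by `e`, the rate function is `l`, with value `0` at the origin. -/
theorem continuousAt_of_continuous_rateFunction
    (hl : ∀ a, 0 < a → Tendsto (fun x : ℝ => h (a * x) / h x) atTop (𝓝 (l a)))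
    (hcont : Continuous (rateFunction h : EuclideanSpace ℝ (Fin d) → ℝ))
    (e : EuclideanSpace ℝ (Fin d)) (he : ‖e‖ = 1) :
    (∀ a, 0 < a → ContinuousAt l a) ∧ Tendsto l (𝓝[>] 0) (𝓝 0) := by
  have he0 : e ≠ 0 := by rintro rfl; simp at he
  have h1 : Continuous fun t : ℝ => rateFunction h (t • e) :=
    hcont.comp (continuous_id.smul continuous_const)
  have h2 : ∀ t : ℝ, 0 < t → rateFunction h (t • e) = l t := by
    intro t ht
    rw [rateFunction_eq hl (smul_ne_zero ht.ne' he0), norm_smul, he, mul_one, Real.norm_eq_abs,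
      abs_of_pos ht]
  constructor
  · intro a ha
    refine h1.continuousAt.congr ?_
    filter_upwards [lt_mem_nhds ha] with t ht using h2 t ht
  · have h3 := (h1.tendsto 0).mono_left (nhdsWithin_le_nhds (s := Set.Ioi 0))
    simp only [zero_smul, rateFunction_zero] at h3
    refine h3.congr' ?_
    filter_upwards [self_mem_nhdsWithin] with t ht using h2 t ht

end rateFunction

/-! ### Truncated exponential moments and the one-dimensional upper bound. -/

theorem exp_le_one_add_add_sq_mul (t : ℝ) :
    Real.exp t ≤ 1 + t + t ^ 2 * Real.exp (max t 0) := by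
  rcases le_total 0 t with ht | ht
  · rw [max_eq_left ht]
    have h1 : Real.exp t * Real.exp (-t) = 1 := by rw [← Real.exp_add]; simp
    have h2 := Real.add_one_le_exp (-t)
    have h3 := Real.exp_pos t
    have h4 : Real.exp t - 1 ≤ t * Real.exp t := by nlinarith
    nlinarith
  · rw [max_eq_right ht, Real.exp_zero, mul_one]
    have h1 : Real.exp t * Real.exp (-t) = 1 := by rw [← Real.exp_add]; simp
    have h2 := Real.add_one_le_exp (-t)
    have h3 := Real.exp_pos t
    have h4 : Real.exp t * (1 - t) ≤ 1 := by nlinarith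
    have h5 : 1 ≤ (1 + t + t ^ 2) * (1 - t) := by nlinarith [mul_nonneg (sq_nonneg t) (neg_nonneg.2 ht)]
    exact le_of_mul_le_mul_right (h4.trans h5) (by linarith)

theorem integrable_comp_nat {Ω : Type*} [MeasurableSpace Ω] {P : Measure Ω} [IsFiniteMeasure P]
    {N : Ω → ℕ} (hN : Measurable N) {φ : ℕ → ℝ} (hφ : ∀ m, 0 ≤ φ m)
    (hs : Summable fun m => φ m * P.real (N ⁻¹' {m})) : Integrable (fun ω => φ (N ω)) P := by
  have h1 : Integrable φ (P.map N) := by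
    refine ⟨(measurable_of_countable φ).aestronglyMeasurable, ?_⟩
    rw [HasFiniteIntegral, lintegral_countable']
    refine lt_of_eq_of_lt (tsum_congr fun m => ?_) hs.tsum_ofReal_lt_top
    rw [Measure.map_apply hN (measurableSet_singleton m), ENNReal.ofReal_mul (hφ m),
      Real.enorm_of_nonneg (hφ m), ofReal_measureReal]
  exact h1.comp_measurable hN

namespace RadialTailAssumption

variable {Ω : Type*} [MeasurableSpace Ω] {P : Measure Ω} [IsProbabilityMeasure P]
  {R : Ω → ℝ} {h : ℝ → ℝ}

/-- The tail at `m - 1` contributes `exp (-(1 - ε / 4) * h (m - 1))`, leaving `exp (-(ε / 4) * h (m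
- 1))`, which beats every power of `m` because `log x = o(h x)`. The absolute value makes the
exponent usable at small `m`. -/
theorem summable_exp_mul_tail (hR : RadialTailAssumption P R h) {ε : ℝ} (hε : 0 < ε) (c : ℝ) :
    Summable fun m : ℕ => (m : ℝ) ^ 2 * Real.exp (c + (1 - ε / 2) * |h (m - 1)|) *
      P.real ((fun ω => ⌈R ω⌉₊) ⁻¹' {m}) := by
  have hs : Summable fun m : ℕ => 16 * Real.exp c * (1 / (m : ℝ) ^ 2) :=
    (Real.summable_one_div_nat_pow.2 one_lt_two).mul_left _
  refine Summable.of_norm_bounded_eventually_nat hs ?_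
  have ht : Tendsto (fun m : ℕ => (m : ℝ) - 1) atTop atTop :=
    tendsto_atTop_add_const_right _ _ tendsto_natCast_atTop_atTop
  filter_upwards [ht.eventually (hR.tail_bounds (show 0 < ε / 4 by positivity)),
    ht.eventually (hR.eventually_mul_log_le (show 0 < 16 / ε by positivity)),
    ht.eventually (hR.tendsto_atTop.eventually_ge_atTop 0), eventually_ge_atTop 2]
    with m h1 h2 h3 hm
  have hm' : (2 : ℝ) ≤ m := by exact_mod_cast hm
  rw [Real.norm_of_nonneg (by positivity), abs_of_nonneg h3]
  have h4 : P.real ((fun ω => ⌈R ω⌉₊) ⁻¹' {m}) ≤ Real.exp (-((1 - ε / 4) * h (m - 1))) := by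
    refine le_trans (measureReal_mono ?_) h1.2
    intro ω hω
    simp only [Set.mem_preimage, Set.mem_singleton_iff] at hω
    rw [Nat.ceil_eq_iff (by omega)] at hω
    have := hω.1
    rw [Nat.cast_sub (by omega), Nat.cast_one] at this
    exact this
  have h5 : Real.exp (-(ε / 4 * h (m - 1))) ≤ 16 / (m : ℝ) ^ 4 := by
    have h6 : 4 * Real.log (m / 2) ≤ ε / 4 * h (m - 1) := by
      have h7 : Real.log (m / 2) ≤ Real.log (m - 1) :=
        Real.log_le_log (by positivity) (by linarith)
      have h8 : ε / 4 * (16 / ε * Real.log (m - 1)) ≤ ε / 4 * h (m - 1) :=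
        mul_le_mul_of_nonneg_left h2 (by positivity)
      have h9 : ε / 4 * (16 / ε * Real.log (m - 1)) = 4 * Real.log (m - 1) := by
        field_simp; ring
      linarith
    calc Real.exp (-(ε / 4 * h (m - 1))) ≤ Real.exp (-(4 * Real.log (m / 2))) :=
          Real.exp_le_exp.2 (neg_le_neg h6)
      _ = ((m / 2 : ℝ) ^ 4)⁻¹ := by
          rw [Real.exp_neg, show (4 : ℝ) * Real.log (m / 2) = (4 : ℕ) * Real.log (m / 2) by norm_num,
            Real.exp_nat_mul, Real.exp_log (by positivity)]
      _ = 16 / (m : ℝ) ^ 4 := by field_simp; norm_num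
  calc (m : ℝ) ^ 2 * Real.exp (c + (1 - ε / 2) * h (m - 1)) *
        P.real ((fun ω => ⌈R ω⌉₊) ⁻¹' {m})
      ≤ (m : ℝ) ^ 2 * Real.exp (c + (1 - ε / 2) * h (m - 1)) *
        Real.exp (-((1 - ε / 4) * h (m - 1))) := by gcongr
    _ = (m : ℝ) ^ 2 * Real.exp c * Real.exp (-(ε / 4 * h (m - 1))) := by
        rw [mul_assoc, mul_assoc, ← Real.exp_add, ← Real.exp_add]
        ring_nf
    _ ≤ (m : ℝ) ^ 2 * Real.exp c * (16 / (m : ℝ) ^ 4) := by gcongr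
    _ = 16 * Real.exp c * (1 / (m : ℝ) ^ 2) := by field_simp

/-- A dominating function for the truncated exponential moments, uniform in the truncation. -/
theorem exists_integrable_dominating (hR : RadialTailAssumption P R h) {ε : ℝ} (hε : 0 < ε)
    (hε1 : ε < 1) :
    ∃ (G : Ω → ℝ) (x₁ : ℝ), Integrable G P ∧ ∀ᵐ ω ∂P, ∀ x, x₁ ≤ x →
      R ω ^ 2 * Real.exp ((1 - ε) * (h x / x) * min (R ω) x) ≤ G ω := by
  obtain ⟨K, hK0, hK⟩ := hR.div_mul_le (half_pos hε)
  obtain ⟨x₀, hm, -⟩ := hR.increasing_concave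
  have hev : ∀ᶠ x in atTop, x₀ ≤ x ∧ 0 < x ∧ 0 ≤ h x ∧ h x / x < 1 := by
    filter_upwards [eventually_ge_atTop x₀, eventually_gt_atTop 0,
      hR.tendsto_atTop.eventually_ge_atTop 0, hR.tendsto_div_id.eventually_lt_const one_pos]
      with x h1 h2 h3 h4 using ⟨h1, h2, h3, h4⟩
  obtain ⟨x₁, hx₁⟩ := eventually_atTop.1 hev
  -- Rounding `R` up to an integer `m` turns integrability into a series. In the exponent, `1` pays
  -- for passing from `m` to `m - 1`, and `K` for values below the range of `div_mul_le`; both use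
  -- that the tilt is at most `1`.
  refine ⟨fun ω => (fun m : ℕ => (m : ℝ) ^ 2 *
    Real.exp (1 + K + (1 - ε / 2) * |h (m - 1)|)) ⌈R ω⌉₊, x₁, ?_, ?_⟩
  · exact integrable_comp_nat (Nat.measurable_ceil.comp hR.measurable) (fun m => by positivity)
      (hR.summable_exp_mul_tail hε (1 + K))
  filter_upwards [hR.nonneg] with ω hω x hx
  obtain ⟨hx0, hxpos, hhx, hhx1⟩ := hx₁ x hx
  have hceil := Nat.le_ceil (R ω)
  generalize ⌈R ω⌉₊ = m at hceil ⊢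
  set lam := (1 - ε) * (h x / x) with hlam
  have hq : 0 ≤ h x / x := div_nonneg hhx hxpos.le
  have hlam0 : 0 ≤ lam := mul_nonneg (by linarith) hq
  have hlam1 : lam ≤ 1 := by nlinarith
  have habs := le_abs_self (h (m - 1))
  have habs0 := abs_nonneg (h ((m : ℝ) - 1))
  have key : lam * min ((m : ℝ) - 1) x ≤ K + (1 - ε / 2) * |h (m - 1)| := by
    rcases le_total K ((m : ℝ) - 1) with hk | hk
    · suffices lam * min ((m : ℝ) - 1) x ≤ (1 - ε / 2) * |h (m - 1)| by linarith
      rcases le_total ((m : ℝ) - 1) x with hkx | hkx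
      · rw [min_eq_left hkx]
        calc lam * ((m : ℝ) - 1) = (1 - ε) * (h x / x * (m - 1)) := by rw [hlam]; ring
          _ ≤ (1 - ε) * ((1 + ε / 2) * h (m - 1)) :=
              mul_le_mul_of_nonneg_left (hK _ _ hk hkx) (by linarith)
          _ ≤ (1 - ε) * ((1 + ε / 2) * |h (m - 1)|) :=
              mul_le_mul_of_nonneg_left (mul_le_mul_of_nonneg_left habs (by linarith)) (by linarith)
          _ ≤ (1 - ε / 2) * |h (m - 1)| := by nlinarith [mul_nonneg (sq_nonneg ε) habs0]
      · rw [min_eq_right hkx]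
        have h1 : h x ≤ h (m - 1) := hm hx0 (hx0.trans hkx) hkx
        calc lam * x = (1 - ε) * h x := by rw [hlam]; field_simp
          _ ≤ (1 - ε) * |h (m - 1)| := mul_le_mul_of_nonneg_left (h1.trans habs) (by linarith)
          _ ≤ (1 - ε / 2) * |h (m - 1)| := by nlinarith
    · have h1 : lam * min ((m : ℝ) - 1) x ≤ lam * K :=
        mul_le_mul_of_nonneg_left ((min_le_left _ _).trans hk) hlam0
      have h2 : lam * K ≤ 1 * K := mul_le_mul_of_nonneg_right hlam1 hK0.le
      have h3 : 0 ≤ (1 - ε / 2) * |h (m - 1)| := mul_nonneg (by linarith) habs0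
      linarith
  have hmin : min (R ω) x ≤ min ((m : ℝ) - 1) x + 1 := by
    rw [← min_add_add_right]
    exact min_le_min (by linarith) (by linarith)
  have h1 : lam * min (R ω) x ≤ 1 + K + (1 - ε / 2) * |h (m - 1)| := by
    have := mul_le_mul_of_nonneg_left hmin hlam0
    linarith
  exact mul_le_mul (pow_le_pow_left₀ hω hceil 2) (Real.exp_le_exp.2 h1) (Real.exp_pos _).le
    (by positivity)

theorem integrable_sq (hR : RadialTailAssumption P R h) : Integrable (fun ω => R ω ^ 2) P := by
  obtain ⟨G, x₁, hG, hdom⟩ := hR.exists_integrable_dominating (ε := 1 / 2) (by norm_num)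
    (by norm_num)
  obtain ⟨x, hx1, hx0, hhx⟩ := ((eventually_ge_atTop x₁).and ((eventually_gt_atTop 0).and
    (hR.tendsto_atTop.eventually_ge_atTop 0))).exists
  refine hG.mono' (hR.measurable.pow_const 2).aestronglyMeasurable ?_
  filter_upwards [hdom, hR.nonneg] with ω h1 h2
  rw [Real.norm_of_nonneg (by positivity)]
  refine le_trans (le_mul_of_one_le_right (by positivity) (Real.one_le_exp ?_)) (h1 x hx1)
  have := le_min h2 hx0.le
  positivity

theorem integrable (hR : RadialTailAssumption P R h) : Integrable R P :=
  ((memLp_two_iff_integrable_sq hR.measurable.aestronglyMeasurable).2 hR.integrable_sq).integrable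
    one_le_two

/-- Truncating from above at `x > 0` can only lower `Z`, so the mean stays nonpositive and the
linear term of the expansion drops. The quadratic term is dominated by the same `G` for all large
`x`. -/
theorem exists_mgf_truncation_le (hR : RadialTailAssumption P R h) {Z : Ω → ℝ}
    (hZ : AEMeasurable Z P) (hZR : ∀ᵐ ω ∂P, |Z ω| ≤ R ω) (hZ0 : ∫ ω, Z ω ∂P ≤ 0)
    {ε : ℝ} (hε : 0 < ε) (hε1 : ε < 1) :
    ∃ C x₁ : ℝ, ∀ x, x₁ ≤ x →
      mgf (fun ω => (Set.Iic x).indicator id (Z ω)) P ((1 - ε) * (h x / x)) ≤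
        Real.exp (C * ((1 - ε) * (h x / x)) ^ 2) := by
  obtain ⟨G, x₁, hG, hdom⟩ := hR.exists_integrable_dominating hε hε1
  obtain ⟨x₂, hx₂⟩ := eventually_atTop.1 ((eventually_ge_atTop x₁).and ((eventually_gt_atTop 0).and
    (hR.tendsto_atTop.eventually_ge_atTop 0)))
  refine ⟨∫ ω, G ω ∂P, x₂, fun x hx => ?_⟩
  obtain ⟨hx1, hx0, hhx⟩ := hx₂ x hx
  set lam := (1 - ε) * (h x / x) with hlam
  have hlam0 : 0 ≤ lam := mul_nonneg (by linarith) (div_nonneg hhx hx0.le)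
  set W : Ω → ℝ := fun ω => (Set.Iic x).indicator id (Z ω) with hW
  have hWm : AEMeasurable W P :=
    (measurable_id.indicator measurableSet_Iic).comp_aemeasurable hZ
  have hWx : ∀ ω, W ω ≤ x := by
    intro ω
    by_cases h1 : Z ω ≤ x <;> simp [hW, Set.indicator, h1, hx0.le]
  have hWZ : ∀ ω, W ω ≤ Z ω := by
    intro ω
    by_cases h1 : Z ω ≤ x
    · simp [hW, Set.indicator, h1]
    · simp only [hW, Set.indicator, Set.mem_Iic, h1, if_false]; linarith
  have hWabs : ∀ ω, |W ω| ≤ |Z ω| := by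
    intro ω
    by_cases h1 : Z ω ≤ x <;> simp [hW, Set.indicator, h1]
  have hZi : Integrable Z P := hR.integrable.mono' hZ.aestronglyMeasurable hZR
  have hWi : Integrable W P := hZi.mono hWm.aestronglyMeasurable (Eventually.of_forall hWabs)
  have hW0 : ∫ ω, W ω ∂P ≤ 0 := (integral_mono hWi hZi hWZ).trans hZ0
  have hpt : ∀ᵐ ω ∂P, Real.exp (lam * W ω) ≤ 1 + lam * W ω + lam ^ 2 * G ω := by
    filter_upwards [hdom, hZR, hR.nonneg] with ω h1 h2 h3
    refine (exp_le_one_add_add_sq_mul _).trans ?_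
    have hWR : |W ω| ≤ R ω := (hWabs ω).trans h2
    have h4 : max (lam * W ω) 0 ≤ lam * min (R ω) x :=
      max_le (mul_le_mul_of_nonneg_left (le_min ((le_abs_self _).trans hWR) (hWx ω)) hlam0)
        (mul_nonneg hlam0 (le_min h3 hx0.le))
    have h5 : W ω ^ 2 ≤ R ω ^ 2 := sq_le_sq' (abs_le.1 hWR).1 (abs_le.1 hWR).2
    have h6 : W ω ^ 2 * Real.exp (max (lam * W ω) 0) ≤ G ω :=
      (mul_le_mul h5 (Real.exp_le_exp.2 h4) (Real.exp_pos _).le (sq_nonneg _)).trans (h1 x hx1)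
    have h7 := mul_le_mul_of_nonneg_left h6 (sq_nonneg lam)
    rw [mul_pow, mul_assoc (lam ^ 2)]
    exact add_le_add le_rfl h7
  have hi1 : Integrable (fun ω => 1 + lam * W ω) P :=
    (integrable_const 1).add (hWi.const_mul lam)
  have hi : Integrable (fun ω => 1 + lam * W ω + lam ^ 2 * G ω) P :=
    hi1.add (hG.const_mul _)
  have hie : Integrable (fun ω => Real.exp (lam * W ω)) P := by
    refine hi.mono' (Real.measurable_exp.comp_aemeasurable
      (hWm.const_mul lam)).aestronglyMeasurable ?_
    filter_upwards [hpt] with ω h1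
    rwa [Real.norm_of_nonneg (Real.exp_pos _).le]
  have h8 : mgf W P lam ≤ ∫ ω, (1 + lam * W ω + lam ^ 2 * G ω) ∂P := integral_mono_ae hie hi hpt
  have h9 : ∫ ω, (1 + lam * W ω + lam ^ 2 * G ω) ∂P
      = 1 + lam * ∫ ω, W ω ∂P + lam ^ 2 * ∫ ω, G ω ∂P := by
    rw [integral_add hi1 (hG.const_mul _),
      integral_add (integrable_const 1) (hWi.const_mul lam), integral_const_mul,
      integral_const_mul]
    simp
  have h10 := Real.add_one_le_exp ((∫ ω, G ω ∂P) * lam ^ 2)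
  have h11 : lam * ∫ ω, W ω ∂P ≤ 0 := mul_nonpos_of_nonneg_of_nonpos hlam0 hW0
  linarith

/-- The upper bound for sums of centred real variables dominated by `R`. -/
theorem measureReal_le_sum_le (hR : RadialTailAssumption P R h) {Z : Ω → ℝ}
    (hZ : AEMeasurable Z P) (hZR : ∀ᵐ ω ∂P, |Z ω| ≤ R ω) (hZ0 : ∫ ω, Z ω ∂P ≤ 0)
    {Y : ℕ → Ω → ℝ} (hindep : iIndepFun Y P) (hident : ∀ i, IdentDistrib (Y i) Z P P)
    {ε : ℝ} (hε : 0 < ε) (hε1 : ε < 1) {s : ℝ} (hs : 0 < s) :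
    ∀ᶠ n : ℕ in atTop, P.real {ω | s * n ≤ ∑ i ∈ Finset.range n, Y i ω} ≤
      2 * Real.exp (-((1 - ε) * h (s * n))) := by
  -- Half of `ε` is lost in the tilt and in the tail bound; the other half absorbs the quadratic
  -- term and the factor `n` of the union bound.
  have hε2 : 0 < ε / 2 := by positivity
  have hε21 : ε / 2 < 1 := by linarith
  obtain ⟨C, x₁, hC⟩ := hR.exists_mgf_truncation_le hZ hZR hZ0 hε2 hε21
  have ht : Tendsto (fun n : ℕ => s * (n : ℝ)) atTop atTop :=
    tendsto_natCast_atTop_atTop.const_mul_atTop hs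
  have hsmall : Tendsto (fun x => C / s * (h x / x)) atTop (𝓝 0) := by
    simpa using hR.tendsto_div_id.const_mul (C / s)
  filter_upwards [ht.eventually (eventually_ge_atTop x₁), ht.eventually (eventually_gt_atTop 0),
    ht.eventually (hR.tendsto_atTop.eventually_ge_atTop 0),
    ht.eventually (eventually_ge_atTop (1 / s)),
    ht.eventually (hR.tail_bounds hε2),
    ht.eventually (hR.eventually_mul_log_le (show 0 < 4 / ε by positivity)),
    ht.eventually (hsmall.eventually_le_const hε2)]
    with n hx1 hx0 hhx hxs htail hlog hsm
  have hns : (n : ℝ) = s * n / s := by field_simp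
  generalize hx : s * (n : ℝ) = x at *
  set lam := (1 - ε / 2) * (h x / x) with hlam
  have hlam0 : 0 ≤ lam := mul_nonneg (by linarith) (div_nonneg hhx hx0.le)
  let T : ℝ → ℝ := (Set.Iic x).indicator id
  have hT : Measurable T := measurable_id.indicator measurableSet_Iic
  have hTx : ∀ y, T y ≤ x := by
    intro y
    by_cases h1 : y ≤ x <;> simp [T, h1, hx0.le]
  have hYm : ∀ i, AEMeasurable (Y i) P := fun i => (hident i).aemeasurable_fst
  have hWm : ∀ i, AEMeasurable (T ∘ Y i) P := fun i => hT.comp_aemeasurable (hYm i)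
  have hWindep : iIndepFun (fun i => T ∘ Y i) P := hindep.comp (fun _ => T) (fun _ => hT)
  have hmgf : mgf (∑ i ∈ Finset.range n, T ∘ Y i) P lam ≤ Real.exp (n * (C * lam ^ 2)) := by
    rw [hWindep.mgf_sum₀ hWm, Real.exp_nat_mul]
    calc ∏ i ∈ Finset.range n, mgf (T ∘ Y i) P lam
        ≤ ∏ i ∈ Finset.range n, Real.exp (C * lam ^ 2) := by
          refine Finset.prod_le_prod (fun i _ => mgf_nonneg) fun i _ => ?_
          rw [mgf_congr_of_identDistrib (T ∘ Y i) (T ∘ Z) ((hident i).comp hT) lam]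
          exact hC x hx1
      _ = Real.exp (C * lam ^ 2) ^ n := by simp
  have hint : Integrable (fun ω => Real.exp (lam * (∑ i ∈ Finset.range n, T ∘ Y i) ω)) P := by
    refine (integrable_const (Real.exp (lam * (n * x)))).mono'
      (Real.measurable_exp.comp_aemeasurable
        ((Finset.aemeasurable_sum _ fun i _ => hWm i).const_mul lam)).aestronglyMeasurable ?_
    refine Eventually.of_forall fun ω => ?_
    rw [Real.norm_of_nonneg (Real.exp_pos _).le, Real.exp_le_exp]
    refine mul_le_mul_of_nonneg_left ?_ hlam0
    rw [Finset.sum_apply]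
    refine (Finset.sum_le_card_nsmul _ _ x fun i _ => hTx _).trans ?_
    simp
  have hch : P.real {ω | x ≤ (∑ i ∈ Finset.range n, T ∘ Y i) ω} ≤
      Real.exp (-((1 - ε) * h x)) := by
    refine (measure_ge_le_exp_mul_mgf x hlam0 hint).trans ?_
    calc Real.exp (-lam * x) * mgf (∑ i ∈ Finset.range n, T ∘ Y i) P lam
        ≤ Real.exp (-lam * x) * Real.exp (n * (C * lam ^ 2)) :=
          mul_le_mul_of_nonneg_left hmgf (Real.exp_pos _).le
      _ ≤ Real.exp (-((1 - ε) * h x)) := by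
          rw [← Real.exp_add, Real.exp_le_exp]
          have e1 : lam * x = (1 - ε / 2) * h x := by rw [hlam]; field_simp
          -- Since `n = x / s`, the quadratic term is `h x` times a multiple of `h x / x`, which
          -- tends to `0`.
          have e2 : n * (C * lam ^ 2) = (1 - ε / 2) ^ 2 * (C / s * (h x / x)) * h x := by
            rw [hns, hlam]; field_simp
          have e3 : (1 - ε / 2) ^ 2 * (C / s * (h x / x)) ≤ ε / 2 := by
            calc (1 - ε / 2) ^ 2 * (C / s * (h x / x)) ≤ (1 - ε / 2) ^ 2 * (ε / 2) :=
                  mul_le_mul_of_nonneg_left hsm (sq_nonneg _)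
              _ ≤ 1 * (ε / 2) := mul_le_mul_of_nonneg_right (by nlinarith) hε2.le
              _ = ε / 2 := one_mul _
          have e4 := mul_le_mul_of_nonneg_right e3 hhx
          rw [neg_mul, e1, e2]
          linarith
  have hmax : P.real (⋃ i ∈ Finset.range n, {ω | x < Y i ω}) ≤ Real.exp (-((1 - ε) * h x)) := by
    have hone : ∀ i, P.real {ω | x < Y i ω} ≤ Real.exp (-((1 - ε / 2) * h x)) := by
      intro i
      refine le_trans ?_ htail.2
      have e1 : P {ω | x < Y i ω} = P {ω | x < Z ω} :=
        (hident i).measure_mem_eq (s := Set.Ioi x) measurableSet_Ioi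
      rw [measureReal_def, e1]
      refine ENNReal.toReal_mono (measure_ne_top _ _) (measure_mono_ae ?_)
      filter_upwards [hZR] with ω h1 h2
      exact lt_of_lt_of_le h2 ((le_abs_self _).trans h1)
    have hn : (n : ℝ) ≤ Real.exp (ε / 2 * h x) := by
      have e1 : 2 * Real.log x ≤ ε / 2 * h x := by
        have := mul_le_mul_of_nonneg_left hlog hε2.le
        have e2 : ε / 2 * (4 / ε * Real.log x) = 2 * Real.log x := by field_simp; ring
        linarith
      calc (n : ℝ) = x * (1 / s) := by rw [hns]; ring
        _ ≤ x * x := mul_le_mul_of_nonneg_left hxs hx0.le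
        _ = Real.exp (2 * Real.log x) := by
            rw [two_mul, Real.exp_add, Real.exp_log hx0]
        _ ≤ _ := Real.exp_le_exp.2 e1
    calc P.real (⋃ i ∈ Finset.range n, {ω | x < Y i ω})
        ≤ ∑ i ∈ Finset.range n, P.real {ω | x < Y i ω} := measureReal_biUnion_finset_le _ _
      _ ≤ n * Real.exp (-((1 - ε / 2) * h x)) := by
          refine (Finset.sum_le_card_nsmul _ _ _ fun i _ => hone i).trans ?_
          simp
      _ ≤ Real.exp (ε / 2 * h x) * Real.exp (-((1 - ε / 2) * h x)) :=
          mul_le_mul_of_nonneg_right hn (Real.exp_pos _).le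
      _ = Real.exp (-((1 - ε) * h x)) := by rw [← Real.exp_add]; ring_nf
  -- Unless some increment exceeds `x`, truncation changes nothing.
  have hsub : {ω | x ≤ ∑ i ∈ Finset.range n, Y i ω} ⊆
      {ω | x ≤ (∑ i ∈ Finset.range n, T ∘ Y i) ω} ∪ ⋃ i ∈ Finset.range n, {ω | x < Y i ω} := by
    intro ω hω
    by_cases h1 : ∃ i ∈ Finset.range n, x < Y i ω
    · right
      simpa using h1
    · left
      push Not at h1
      rw [Set.mem_ofPred_eq, Finset.sum_apply]
      refine le_of_le_of_eq hω (Finset.sum_congr rfl fun i hi => ?_)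
      simp [T, Set.indicator, h1 i hi]
  calc _ ≤ _ := measureReal_mono hsub
    _ ≤ _ := measureReal_union_le _ _
    _ ≤ _ := by linarith

end RadialTailAssumption

/-! ### The upper bound for the norm of the walk. -/

/-- Take a finite `η`-net of the compact unit sphere and the net point `u` nearest in direction: `x`
differs from `‖x‖ • u` by at most `η * ‖x‖`. -/
theorem exists_finset_norm_le_inner {E : Type*} [NormedAddCommGroup E] [InnerProductSpace ℝ E]
    [FiniteDimensional ℝ E] {η : ℝ} (hη : 0 < η) :
    ∃ T : Finset E, (∀ u ∈ T, ‖u‖ = 1) ∧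
      ∀ x : E, x ≠ 0 → ∃ u ∈ T, (1 - η) * ‖x‖ ≤ inner ℝ u x := by
  have : ProperSpace E := FiniteDimensional.proper_real E
  obtain ⟨t, hts, htf, hcov⟩ := (isCompact_sphere (0 : E) 1).finite_cover_balls hη
  refine ⟨htf.toFinset, fun u hu => by simpa using hts (htf.mem_toFinset.1 hu), fun x hx => ?_⟩
  have hx0 : 0 < ‖x‖ := norm_pos_iff.2 hx
  have h1 : ‖x‖⁻¹ • x ∈ Metric.sphere (0 : E) 1 := by
    simp [norm_smul, hx0.ne']
  obtain ⟨u, hu, hux⟩ := Set.mem_iUnion₂.1 (hcov h1)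
  refine ⟨u, htf.mem_toFinset.2 hu, ?_⟩
  rw [Metric.mem_ball, dist_eq_norm] at hux
  have h2 : ‖x - ‖x‖ • u‖ ≤ η * ‖x‖ := by
    have h3 : x - ‖x‖ • u = ‖x‖ • (‖x‖⁻¹ • x - u) := by
      rw [smul_sub, smul_smul, mul_inv_cancel₀ hx0.ne', one_smul]
    rw [h3, norm_smul, norm_norm, mul_comm]
    exact mul_le_mul_of_nonneg_right hux.le hx0.le
  have hu1 : ‖u‖ = 1 := by simpa using hts hu
  have h4 : inner ℝ u (x - ‖x‖ • u) = inner ℝ u x - ‖x‖ := by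
    rw [inner_sub_right, inner_smul_right, real_inner_self_eq_norm_sq, hu1]; ring
  have h5 := (abs_le.1 (abs_real_inner_le_norm u (x - ‖x‖ • u))).1
  rw [hu1, one_mul, h4] at h5
  linarith

section

variable {Ω : Type*} [MeasurableSpace Ω] {P : Measure Ω}
  {d : ℕ} {R : Ω → ℝ} {h l : ℝ → ℝ} {U : Ω → Metric.sphere (0 : EuclideanSpace ℝ (Fin d)) 1}

theorem measurable_smul_direction (hR : RadialTailAssumption P R h)
    (hU : DirectionAssumption P R U) :
    Measurable fun ω => R ω • (U ω : EuclideanSpace ℝ (Fin d)) :=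
  hR.measurable.smul (measurable_subtype_coe.comp hU.measurable)

theorem RadialTailAssumption.eventually_lt_mul (hR : RadialTailAssumption P R h)
    (hl : ∀ a, 0 < a → Tendsto (fun x : ℝ => h (a * x) / h x) atTop (𝓝 (l a)))
    {a k c : ℝ} (ha : 0 < a) (hc : k * l a < c) :
    ∀ᶠ n : ℕ in atTop, k * h (a * n) < c * h n := by
  have h1 := (((hl a ha).const_mul k).comp tendsto_natCast_atTop_atTop).eventually_lt_const hc
  filter_upwards [h1, (hR.tendsto_atTop.comp tendsto_natCast_atTop_atTop).eventually_gt_atTop 0]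
    with n h2 h3
  simp only [Function.comp_apply] at h2 h3
  rwa [← mul_div_assoc, div_lt_iff₀ h3] at h2

theorem RadialTailAssumption.eventually_mul_lt (hR : RadialTailAssumption P R h)
    (hl : ∀ a, 0 < a → Tendsto (fun x : ℝ => h (a * x) / h x) atTop (𝓝 (l a)))
    {a k c : ℝ} (ha : 0 < a) (hc : c < k * l a) :
    ∀ᶠ n : ℕ in atTop, c * h n < k * h (a * n) := by
  filter_upwards [hR.eventually_lt_mul hl ha (show -k * l a < -c by linarith)] with n hn
  linarith

theorem RadialTailAssumption.eventually_le_mul_exp (hR : RadialTailAssumption P R h)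
    {c q : ℝ} (hc : 0 < c) (hq : 0 < q) :
    ∀ᶠ n : ℕ in atTop, Real.exp (-(c * h n)) ≤ q := by
  have h1 : Tendsto (fun n : ℕ => Real.exp (-(c * h n))) atTop (𝓝 0) :=
    Real.tendsto_exp_neg_atTop_nhds_zero.comp
      ((hR.tendsto_atTop.comp tendsto_natCast_atTop_atTop).const_mul_atTop hc)
  exact h1.eventually_le_const hq

variable [IsProbabilityMeasure P]

theorem integrable_smul_direction (hR : RadialTailAssumption P R h)
    (hU : DirectionAssumption P R U) :
    Integrable (fun ω => R ω • (U ω : EuclideanSpace ℝ (Fin d))) P := by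
  refine hR.integrable.mono (measurable_smul_direction hR hU).aestronglyMeasurable
    (Eventually.of_forall fun ω => ?_)
  simp [norm_smul]

/-- A large norm forces a large projection on one of finitely many directions, and the projections
are centred and dominated by `R`. Continuity of `l` at `r` makes the loss from `r` to `(1 - ε) * r`
harmless. -/
theorem measureReal_le_norm_randomWalk_le (hR : RadialTailAssumption P R h)
    (hU : DirectionAssumption P R U)
    (hl : ∀ a, 0 < a → Tendsto (fun x : ℝ => h (a * x) / h x) atTop (𝓝 (l a)))
    {X : ℕ → Ω → EuclideanSpace ℝ (Fin d)} (hindep : iIndepFun X P)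
    (hident : ∀ i, IdentDistrib (X i)
      (fun ω => R ω • (U ω : EuclideanSpace ℝ (Fin d))) P P)
    {r c : ℝ} (hr : 0 < r) (hlr : ContinuousAt l r) (hc : c < l r) :
    ∀ᶠ n : ℕ in atTop, P.real {ω | r * n ≤ ‖randomWalk X n ω‖} ≤ Real.exp (-(c * h n)) := by
  obtain ⟨ε, ⟨hcε, hε1⟩, hε : 0 < ε⟩ : ∃ ε, (c < (1 - ε) * l ((1 - ε) * r) ∧ ε < 1) ∧ 0 < ε := by
    have h1 : Tendsto (fun ε : ℝ => (1 - ε) * l ((1 - ε) * r)) (𝓝 0) (𝓝 ((1 - 0) * l r)) := by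
      have h2 : Tendsto (fun ε : ℝ => 1 - ε) (𝓝 0) (𝓝 (1 - 0)) :=
        (continuous_const.sub continuous_id).tendsto 0
      refine h2.mul (hlr.tendsto.comp ?_)
      simpa using h2.mul_const r
    rw [sub_zero, one_mul] at h1
    exact (((h1.eventually_const_lt hc).filter_mono nhdsWithin_le_nhds).and
      ((eventually_lt_nhds one_pos).filter_mono nhdsWithin_le_nhds) |>.and
      (self_mem_nhdsWithin (s := Set.Ioi (0 : ℝ)))).exists
  set s := (1 - ε) * r with hs
  have hs0 : 0 < s := mul_pos (by linarith) hr
  obtain ⟨c', hcc', hc'⟩ := exists_between hcε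
  obtain ⟨T, hT1, hT⟩ := exists_finset_norm_le_inner (E := EuclideanSpace ℝ (Fin d)) hε
  have hone : ∀ u ∈ T, ∀ᶠ n : ℕ in atTop,
      P.real {ω | s * n ≤ ∑ i ∈ Finset.range n, inner ℝ u (X i ω)} ≤
        2 * Real.exp (-((1 - ε) * h (s * n))) := by
    intro u hu
    have hm : Measurable fun x : EuclideanSpace ℝ (Fin d) => inner ℝ u x := by fun_prop
    refine hR.measureReal_le_sum_le
      (Z := fun ω => inner ℝ u (R ω • (U ω : EuclideanSpace ℝ (Fin d))))
      (hm.comp (measurable_smul_direction hR hU)).aemeasurable ?_ ?_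
      (hindep.comp (fun _ x => inner ℝ u x) fun _ => hm) (fun i => (hident i).comp hm)
      hε hε1 hs0
    · filter_upwards [hR.nonneg] with ω hω
      refine (abs_real_inner_le_norm _ _).trans ?_
      simp [hT1 u hu, norm_smul, abs_of_nonneg hω]
    · rw [integral_inner (integrable_smul_direction hR hU), hU.mean_zero, inner_zero_right]
  have hall := (Finset.eventually_all T).2 hone
  -- The gap `c' - c` pays for the factor `2 * T.card`; the `+ 1` keeps the denominator positive.
  filter_upwards [hall, hR.eventually_mul_lt hl hs0 hc',
    hR.eventually_le_mul_exp (sub_pos.2 hcc') (q := 1 / (2 * (T.card + 1))) (by positivity),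
    eventually_gt_atTop 0] with n hn h1 h2 hn0
  have hn0' : (0 : ℝ) < n := by exact_mod_cast hn0
  have hsub : {ω | r * n ≤ ‖randomWalk X n ω‖} ⊆
      ⋃ u ∈ T, {ω | s * n ≤ ∑ i ∈ Finset.range n, inner ℝ u (X i ω)} := by
    intro ω hω
    have h3 : 0 < ‖randomWalk X n ω‖ := (mul_pos hr hn0').trans_le hω
    obtain ⟨u, hu, hu2⟩ := hT _ (norm_pos_iff.1 h3)
    refine Set.mem_iUnion₂.2 ⟨u, hu, ?_⟩
    rw [Set.mem_ofPred_eq, ← inner_sum]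
    refine le_trans ?_ hu2
    rw [hs, mul_assoc]
    exact mul_le_mul_of_nonneg_left hω (by linarith)
  have h3 : (T.card : ℝ) * (2 * Real.exp (-((c' - c) * h n))) ≤ 1 := by
    rw [le_div_iff₀ (by positivity)] at h2
    nlinarith [Real.exp_pos (-((c' - c) * h n))]
  calc P.real {ω | r * n ≤ ‖randomWalk X n ω‖}
      ≤ ∑ u ∈ T, P.real {ω | s * n ≤ ∑ i ∈ Finset.range n, inner ℝ u (X i ω)} :=
        (measureReal_mono hsub (measure_ne_top _ _)).trans (measureReal_biUnion_finset_le _ _)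
    _ ≤ T.card * (2 * Real.exp (-(c' * h n))) := by
        rw [← nsmul_eq_mul]
        refine Finset.sum_le_card_nsmul _ _ _ fun u hu => (hn u hu).trans ?_
        have := Real.exp_le_exp.2 (neg_le_neg h1.le)
        linarith
    _ = T.card * (2 * Real.exp (-((c' - c) * h n))) * Real.exp (-(c * h n)) := by
        rw [show -(c' * h n) = -((c' - c) * h n) + -(c * h n) by ring, Real.exp_add]; ring
    _ ≤ Real.exp (-(c * h n)) := mul_le_of_le_one_left (Real.exp_pos _).le h3

/-! ### The lower bound by one big jump. -/

/-- The jump is realised by `a * n < R ≤ b * n` with `U` near the direction of `x₀`. Asymptotic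
independence gives a fixed fraction of the tail at `a * n`, and removing the tail at `b * n` is
negligible because `l a < l b`. -/
theorem exp_le_measureReal_single (hR : RadialTailAssumption P R h)
    (hU : DirectionAssumption P R U)
    (hl : ∀ a, 0 < a → Tendsto (fun x : ℝ => h (a * x) / h x) atTop (𝓝 (l a)))
    (hl0 : Tendsto l (𝓝[>] 0) (𝓝 0))
    {x₀ : EuclideanSpace ℝ (Fin d)} (hx₀ : x₀ ≠ 0) {δ c : ℝ} (hδ : 0 < δ) (hc : l ‖x₀‖ < c) :
    ∀ᶠ n : ℕ in atTop, Real.exp (-(c * h n)) ≤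
      P.real {ω | ‖R ω • (U ω : EuclideanSpace ℝ (Fin d)) - (n : ℝ) • x₀‖ < δ * n} := by
  set a := ‖x₀‖ with ha_def
  have ha : 0 < a := norm_pos_iff.2 hx₀
  -- Thus `b = a + δ / 2`: the radial error is at most `δ / 2 * n`, and the angular radius `δ / (2 *
  -- b)` adds less than `δ / 2 * n`.
  set b := a + δ / (2 * a) * a with hb_def
  have hbδ : b = a + δ / 2 := by rw [hb_def]; field_simp
  have hb : 0 < b := by rw [hbδ]; positivity
  have hab : l a < l b := hR.limit_strictMono hl hl0 ha (by rw [hbδ]; linarith)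
  set e₀ : Metric.sphere (0 : EuclideanSpace ℝ (Fin d)) 1 :=
    ⟨a⁻¹ • x₀, by simp [norm_smul, ← ha_def, ha.ne', abs_of_pos ha]⟩ with he₀
  set S : Set (Metric.sphere (0 : EuclideanSpace ℝ (Fin d)) 1) :=
    Metric.ball e₀ (δ / (2 * b)) with hS
  have hSm : MeasurableSet S := Metric.isOpen_ball.measurableSet
  have hSpos : 0 < (volume : Measure (EuclideanSpace ℝ (Fin d))).toSphere S :=
    Metric.measure_ball_pos _ _ (by positivity)
  set q := P.real (U ⁻¹' S) with hq
  have hq0 : 0 < q := ENNReal.toReal_pos (hU.pos S hSm hSpos).ne' (measure_ne_top _ _)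
  have hind : Tendsto (fun x : ℝ => (P[U ⁻¹' S | {ω | x < R ω}]).toReal) atTop (𝓝 q) :=
    (ENNReal.tendsto_toReal (measure_ne_top _ _)).comp (hU.asymptotically_indep S hSm hSpos)
  obtain ⟨ε, ⟨hε1, hε2⟩, hε : 0 < ε⟩ :
      ∃ ε, ((1 + ε) * l a < c ∧ (1 + ε) * l a < (1 - ε) * l b) ∧ 0 < ε := by
    have h1 : Tendsto (fun ε : ℝ => (1 + ε) * l a) (𝓝 0) (𝓝 ((1 + 0) * l a)) :=
      Continuous.tendsto (by fun_prop) 0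
    have h2 : Tendsto (fun ε : ℝ => (1 - ε) * l b) (𝓝 0) (𝓝 ((1 - 0) * l b)) :=
      Continuous.tendsto (by fun_prop) 0
    rw [add_zero, one_mul] at h1
    rw [sub_zero, one_mul] at h2
    exact (((h1.eventually_lt_const hc).filter_mono nhdsWithin_le_nhds).and
      ((h1.eventually_lt h2 hab).filter_mono nhdsWithin_le_nhds) |>.and
      (self_mem_nhdsWithin (s := Set.Ioi (0 : ℝ)))).exists
  -- The order is `(1 + ε) * l a < γ₁ < γ₂ < (1 - ε) * l b` with `γ₁ < c`: `γ₁` bounds the tail at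
  -- `a * n` from below, `γ₂` the tail at `b * n` from above.
  obtain ⟨γ₁, hγ₁, hγ₁'⟩ := exists_between (lt_min hε1 hε2)
  have hγc : γ₁ < c := hγ₁'.trans_le (min_le_left _ _)
  obtain ⟨γ₂, hγ₂, hγ₂'⟩ := exists_between (hγ₁'.trans_le (min_le_right _ _))
  have hta : Tendsto (fun n : ℕ => a * (n : ℝ)) atTop atTop :=
    tendsto_natCast_atTop_atTop.const_mul_atTop ha
  have htb : Tendsto (fun n : ℕ => b * (n : ℝ)) atTop atTop :=
    tendsto_natCast_atTop_atTop.const_mul_atTop hb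
  filter_upwards [hta.eventually (hR.tail_bounds hε), htb.eventually (hR.tail_bounds hε),
    hta.eventually (hind.eventually_const_lt (half_lt_self hq0)),
    hR.eventually_lt_mul hl ha hγ₁, hR.eventually_mul_lt hl hb hγ₂',
    hR.eventually_le_mul_exp (sub_pos.2 hγc) (show 0 < q / 4 by positivity),
    hR.eventually_le_mul_exp (sub_pos.2 hγ₂) (show 0 < q / 4 by positivity),
    eventually_gt_atTop 0, hta.eventually_ge_atTop 0] with n h1 h2 h3 h4 h5 h6 h7 hn0 han
  have hn0' : (0 : ℝ) < n := by exact_mod_cast hn0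
  have hCm : MeasurableSet {ω | a * n < R ω} := measurableSet_lt measurable_const hR.measurable
  have hinter : P.real ({ω | a * n < R ω} ∩ U ⁻¹' S) =
      (P[U ⁻¹' S | {ω | a * n < R ω}]).toReal * P.real {ω | a * n < R ω} := by
    rw [measureReal_def, measureReal_def, ← ENNReal.toReal_mul, cond_mul_eq_inter hCm]
  have hsub : {ω | a * n < R ω} ∩ U ⁻¹' S ⊆
      {ω | ‖R ω • (U ω : EuclideanSpace ℝ (Fin d)) - (n : ℝ) • x₀‖ < δ * n} ∪
        {ω | b * n < R ω} := by
    rintro ω ⟨hω1, hω2⟩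
    rcases lt_or_ge (b * n) (R ω) with hω3 | hω3
    · exact Or.inr hω3
    left
    have hRω : 0 < R ω := lt_of_le_of_lt han hω1
    have hdist : ‖(U ω : EuclideanSpace ℝ (Fin d)) - a⁻¹ • x₀‖ < δ / (2 * b) := by
      have : dist (U ω) e₀ < δ / (2 * b) := hω2
      rwa [Subtype.dist_eq, dist_eq_norm] at this
    have hdec : R ω • (U ω : EuclideanSpace ℝ (Fin d)) - (n : ℝ) • x₀ =
        R ω • ((U ω : EuclideanSpace ℝ (Fin d)) - a⁻¹ • x₀) + (R ω * a⁻¹ - n) • x₀ := by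
      rw [smul_sub, sub_smul, mul_smul]; abel
    have hB1 : ‖R ω • ((U ω : EuclideanSpace ℝ (Fin d)) - a⁻¹ • x₀)‖ < δ / 2 * n := by
      rw [norm_smul, Real.norm_of_nonneg hRω.le]
      calc R ω * ‖(U ω : EuclideanSpace ℝ (Fin d)) - a⁻¹ • x₀‖ < R ω * (δ / (2 * b)) :=
            mul_lt_mul_of_pos_left hdist hRω
        _ ≤ b * n * (δ / (2 * b)) := mul_le_mul_of_nonneg_right hω3 (by positivity)
        _ = δ / 2 * n := by field_simp
    have hB2 : ‖(R ω * a⁻¹ - n) • x₀‖ ≤ δ / 2 * n := by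
      rw [norm_smul, ← ha_def, Real.norm_eq_abs]
      have e1 : R ω * a⁻¹ - n = (R ω - a * n) * a⁻¹ := by field_simp
      have hω1' : a * n < R ω := hω1
      rw [e1, abs_of_nonneg (mul_nonneg (by linarith) (inv_pos.2 ha).le), mul_assoc,
        inv_mul_cancel₀ ha.ne', mul_one]
      rw [hbδ] at hω3
      linarith
    rw [Set.mem_ofPred_eq, hdec]
    calc _ ≤ _ := norm_add_le _ _
      _ < δ * n := by linarith
  have hle := (measureReal_mono (μ := P) hsub).trans (measureReal_union_le _ _)
  rw [hinter] at hle
  have hA : Real.exp (-(γ₁ * h n)) ≤ P.real {ω | a * n < R ω} :=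
    (Real.exp_le_exp.2 (neg_le_neg h4.le)).trans h1.1
  have hBb : P.real {ω | b * n < R ω} ≤ q / 4 * Real.exp (-(γ₁ * h n)) := by
    calc P.real {ω | b * n < R ω} ≤ Real.exp (-(γ₂ * h n)) :=
          h2.2.trans (Real.exp_le_exp.2 (neg_le_neg h5.le))
      _ = Real.exp (-((γ₂ - γ₁) * h n)) * Real.exp (-(γ₁ * h n)) := by
          rw [← Real.exp_add]; ring_nf
      _ ≤ _ := mul_le_mul_of_nonneg_right h7 (Real.exp_pos _).le
  have hC : q / 2 * Real.exp (-(γ₁ * h n)) ≤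
      (P[U ⁻¹' S | {ω | a * n < R ω}]).toReal * P.real {ω | a * n < R ω} :=
    mul_le_mul h3.le hA (Real.exp_pos _).le ENNReal.toReal_nonneg
  calc Real.exp (-(c * h n)) = Real.exp (-((c - γ₁) * h n)) * Real.exp (-(γ₁ * h n)) := by
        rw [← Real.exp_add]; ring_nf
    _ ≤ q / 4 * Real.exp (-(γ₁ * h n)) := mul_le_mul_of_nonneg_right h6 (Real.exp_pos _).le
    _ ≤ _ := by linarith

theorem tendsto_measureReal_norm_randomWalk (hR : RadialTailAssumption P R h)
    (hU : DirectionAssumption P R U)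
    {X : ℕ → Ω → EuclideanSpace ℝ (Fin d)} (hindep : iIndepFun X P)
    (hident : ∀ i, IdentDistrib (X i)
      (fun ω => R ω • (U ω : EuclideanSpace ℝ (Fin d))) P P) {δ : ℝ} (hδ : 0 < δ) :
    ∀ᶠ n : ℕ in atTop, 1 / 2 ≤ P.real {ω | ‖randomWalk X n ω‖ < δ * n} := by
  have hm : ∀ i, AEMeasurable (X i) P := fun i => (hident i).aemeasurable_fst
  have hint : Integrable (X 0) P := (hident 0).integrable_iff.2 (integrable_smul_direction hR hU)
  have hlln := strong_law_ae X hint (fun i j hij => hindep.indepFun hij)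
    (fun i => (hident i).trans (hident 0).symm)
  rw [(hident 0).integral_eq, hU.mean_zero] at hlln
  have hmeas : ∀ n : ℕ, AEStronglyMeasurable
      (fun ω => (n : ℝ)⁻¹ • ∑ i ∈ Finset.range n, X i ω) P := fun n =>
    ((Finset.aemeasurable_fun_sum _ fun i _ => hm i).const_smul (n : ℝ)⁻¹).aestronglyMeasurable
  have h1 := tendstoInMeasure_of_tendsto_ae hmeas hlln
  have h2 := (tendstoInMeasure_iff_measureReal_norm.1 h1) δ hδ
  filter_upwards [h2.eventually_le_const (show (0 : ℝ) < 1 / 2 by norm_num), eventually_gt_atTop 0]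
    with n hn hn0
  have hn0' : (0 : ℝ) < n := by exact_mod_cast hn0
  have h3 : (1 : ℝ) ≤ P.real {ω | ‖randomWalk X n ω‖ < δ * n} +
      P.real {ω | δ ≤ ‖(n : ℝ)⁻¹ • ∑ i ∈ Finset.range n, X i ω - 0‖} := by
    refine le_trans ?_ (measureReal_union_le _ _)
    rw [← probReal_univ (μ := P)]
    refine measureReal_mono fun ω _ => ?_
    rcases lt_or_ge ‖randomWalk X n ω‖ (δ * n) with h4 | h4
    · exact Or.inl h4
    · right
      rw [Set.mem_ofPred_eq, sub_zero, norm_smul, norm_inv, RCLike.norm_natCast, ← div_eq_inv_mul,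
        le_div_iff₀ hn0']
      exact h4
  linarith

/-- The lower bound: one big increment together with the law of large numbers. -/
theorem exp_le_measureReal_randomWalk (hR : RadialTailAssumption P R h)
    (hU : DirectionAssumption P R U)
    (hl : ∀ a, 0 < a → Tendsto (fun x : ℝ => h (a * x) / h x) atTop (𝓝 (l a)))
    (hl0 : Tendsto l (𝓝[>] 0) (𝓝 0))
    {X : ℕ → Ω → EuclideanSpace ℝ (Fin d)} (hindep : iIndepFun X P)
    (hident : ∀ i, IdentDistrib (X i)
      (fun ω => R ω • (U ω : EuclideanSpace ℝ (Fin d))) P P)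
    {x₀ : EuclideanSpace ℝ (Fin d)} (hx₀ : x₀ ≠ 0) {δ c : ℝ} (hδ : 0 < δ) (hc : l ‖x₀‖ < c) :
    ∀ᶠ n : ℕ in atTop, Real.exp (-(c * h n)) ≤
      P.real {ω | ‖randomWalk X n ω - (n : ℝ) • x₀‖ < δ * n} := by
  obtain ⟨c', hc', hcc'⟩ := exists_between hc
  have hδ2 : 0 < δ / 2 := by positivity
  have hlln := tendsto_measureReal_norm_randomWalk hR hU hindep hident hδ2
  obtain ⟨N, hN⟩ := eventually_atTop.1 hlln
  have hm : ∀ i, AEMeasurable (X i) P := fun i => (hident i).aemeasurable_fst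
  filter_upwards [exp_le_measureReal_single hR hU hl hl0 hx₀ hδ2 hc',
    hR.eventually_le_mul_exp (sub_pos.2 hcc') (show (0 : ℝ) < 1 / 2 by norm_num),
    eventually_gt_atTop N] with n h1 h2 hn
  -- The big increment is the last one, `X m`; the first `m` form an independent walk staying small
  -- with probability at least `1 / 2`.
  obtain ⟨m, rfl⟩ : ∃ m, n = m + 1 := ⟨n - 1, by omega⟩
  have h3 := hN m (by omega)
  set A : Set (EuclideanSpace ℝ (Fin d)) := {x | ‖x‖ < δ / 2 * m} with hA
  set B : Set (EuclideanSpace ℝ (Fin d)) :=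
    {x | ‖x - ((m + 1 : ℕ) : ℝ) • x₀‖ < δ / 2 * (m + 1 : ℕ)} with hB
  have hAm : MeasurableSet A := measurableSet_lt (by fun_prop) (by fun_prop)
  have hBm : MeasurableSet B := measurableSet_lt (by fun_prop) (by fun_prop)
  have h4 : P.real ((∑ j ∈ Finset.range m, X j) ⁻¹' A ∩ X m ⁻¹' B) =
      P.real ((∑ j ∈ Finset.range m, X j) ⁻¹' A) * P.real (X m ⁻¹' B) := by
    rw [measureReal_def, measureReal_def, measureReal_def, ← ENNReal.toReal_mul,
      (hindep.indepFun_sum_range_succ₀ hm m).measure_inter_preimage_eq_mul A B hAm hBm]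
  have h5 : P.real (X m ⁻¹' B) =
      P.real {ω | ‖R ω • (U ω : EuclideanSpace ℝ (Fin d)) - ((m + 1 : ℕ) : ℝ) • x₀‖ <
        δ / 2 * (m + 1 : ℕ)} := by
    rw [measureReal_def, (hident m).measure_mem_eq hBm, measureReal_def]
    rfl
  have h6 : (∑ j ∈ Finset.range m, X j) ⁻¹' A = {ω | ‖randomWalk X m ω‖ < δ / 2 * m} := by
    ext ω
    simp [A, randomWalk]
  have hsub : (∑ j ∈ Finset.range m, X j) ⁻¹' A ∩ X m ⁻¹' B ⊆
      {ω | ‖randomWalk X (m + 1) ω - ((m + 1 : ℕ) : ℝ) • x₀‖ < δ * (m + 1 : ℕ)} := by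
    rw [h6]
    rintro ω ⟨hω1, hω2⟩
    have e1 : ‖X m ω - ((m + 1 : ℕ) : ℝ) • x₀‖ < δ / 2 * (m + 1 : ℕ) := hω2
    have e2 : ‖randomWalk X m ω‖ < δ / 2 * m := hω1
    have e3 : randomWalk X (m + 1) ω - ((m + 1 : ℕ) : ℝ) • x₀ =
        randomWalk X m ω + (X m ω - ((m + 1 : ℕ) : ℝ) • x₀) := by
      rw [randomWalk, Finset.sum_range_succ, randomWalk]; abel
    rw [Set.mem_ofPred_eq, e3]
    have e4 := norm_add_le (randomWalk X m ω) (X m ω - ((m + 1 : ℕ) : ℝ) • x₀)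
    push_cast at *
    linarith
  calc Real.exp (-(c * h (m + 1 : ℕ)))
      = Real.exp (-((c - c') * h (m + 1 : ℕ))) * Real.exp (-(c' * h (m + 1 : ℕ))) := by
        rw [← Real.exp_add]; ring_nf
    _ ≤ P.real ((∑ j ∈ Finset.range m, X j) ⁻¹' A) * P.real (X m ⁻¹' B) := by
        rw [h5, h6]
        exact mul_le_mul (h2.trans h3) h1 (Real.exp_pos _).le measureReal_nonneg
    _ ≤ _ := h4 ▸ measureReal_mono hsub

end

/-! ### Logarithmic limits in `EReal` and the theorem. -/

theorem log_div_le_of_measureReal_le {Ω : Type*} [MeasurableSpace Ω] {P : Measure Ω}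
    [IsFiniteMeasure P] {A : Set Ω} {y c : ℝ} (hy : 0 < y)
    (hA : P.real A ≤ Real.exp (-(c * y))) :
    ENNReal.log (P A) / ((y : ℝ) : EReal) ≤ ((-c : ℝ) : EReal) := by
  rw [EReal.div_le_iff_le_mul (by exact_mod_cast hy) (EReal.coe_ne_top _)]
  have h1 : P A ≤ ENNReal.ofReal (Real.exp (-(c * y))) := by
    rw [← ofReal_measureReal]
    exact ENNReal.ofReal_le_ofReal hA
  refine (ENNReal.log_monotone h1).trans ?_
  rw [ENNReal.log_ofReal_of_pos (Real.exp_pos _), Real.log_exp, ← EReal.coe_mul]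
  exact_mod_cast (by linarith : -(c * y) ≤ y * -c)

theorem le_log_div_of_le_measureReal {Ω : Type*} [MeasurableSpace Ω] {P : Measure Ω}
    [IsFiniteMeasure P] {A : Set Ω} {y c : ℝ} (hy : 0 < y)
    (hA : Real.exp (-(c * y)) ≤ P.real A) :
    ((-c : ℝ) : EReal) ≤ ENNReal.log (P A) / ((y : ℝ) : EReal) := by
  rw [EReal.le_div_iff_mul_le (by exact_mod_cast hy) (EReal.coe_ne_top _)]
  have h1 : ENNReal.ofReal (Real.exp (-(c * y))) ≤ P A := by
    rw [← ofReal_measureReal]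
    exact ENNReal.ofReal_le_ofReal hA
  refine le_trans ?_ (ENNReal.log_monotone h1)
  rw [ENNReal.log_ofReal_of_pos (Real.exp_pos _), Real.log_exp, ← EReal.coe_mul]
  exact_mod_cast (by linarith : -c * y ≤ -(c * y))

theorem mainTheorem6 {Ω : Type*} [MeasurableSpace Ω] (P : Measure Ω) [IsProbabilityMeasure P]
    {d : ℕ} (h : ℝ → ℝ) (R : Ω → ℝ) (U : Ω → Metric.sphere (0 : EuclideanSpace ℝ (Fin d)) 1)
    (hR : RadialTailAssumption P R h) (hU : DirectionAssumption P R U)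
    (hlim : ∀ a : ℝ, 0 < a → ∃ l : ℝ, Tendsto (fun x : ℝ => h (a * x) / h x) atTop (𝓝 l))
    (X : ℕ → Ω → EuclideanSpace ℝ (Fin d)) (hindep : iIndepFun X P)
    (hident : ∀ i, IdentDistrib (X i)
      (fun ω => R ω • (U ω : EuclideanSpace ℝ (Fin d))) P P)
    (hcont : Continuous (rateFunction h : EuclideanSpace ℝ (Fin d) → ℝ))
    (B : Set (EuclideanSpace ℝ (Fin d))) (hB : MeasurableSet B)
    (hBcl : closure (interior B) = closure B) :
    Tendsto
      (fun n : ℕ => ENNReal.log (P {ω | randomWalk X n ω ∈ (n : ℝ) • B}) / ((h n : ℝ) : EReal))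
      atTop (𝓝 (-(⨅ x ∈ B, ((rateFunction h x : ℝ) : EReal)))) := by
  choose! l hl using hlim
  -- A value of `U` is a unit vector, which rules out `d = 0`.
  obtain ⟨ω₀⟩ : Nonempty Ω := nonempty_of_isProbabilityMeasure P
  have he : ‖(U ω₀ : EuclideanSpace ℝ (Fin d))‖ = 1 := by simp
  obtain ⟨hlc, hl0⟩ := continuousAt_of_continuous_rateFunction hl hcont _ he
  have : Nontrivial (EuclideanSpace ℝ (Fin d)) :=
    ⟨⟨(U ω₀ : EuclideanSpace ℝ (Fin d)), 0, fun h0 => by simp [h0] at he⟩⟩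
  have hpos : ∀ᶠ n : ℕ in atTop, 0 < h n :=
    (hR.tendsto_atTop.comp tendsto_natCast_atTop_atTop).eventually_gt_atTop 0
  set m : EReal := ⨅ x ∈ B, ((rateFunction h x : ℝ) : EReal) with hm
  refine tendsto_order.2 ⟨fun z hz => ?_, fun z hz => ?_⟩
  · have hz' : m < -z := EReal.lt_neg_comm.1 hz
    obtain ⟨x, hx, hxz⟩ : ∃ x ∈ B, ((rateFunction h x : ℝ) : EReal) < -z := by
      simpa [hm, iInf_lt_iff] using hz'
    obtain ⟨c, hxc, hcz⟩ := EReal.lt_iff_exists_real_btwn.1 hxz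
    have hopen : IsOpen {y : EuclideanSpace ℝ (Fin d) | rateFunction h y < c} :=
      isOpen_lt hcont continuous_const
    -- The infimum may be approached only at `0`, which has no direction to jump in; a nearby
    -- nonzero interior point of `B` has rate still below `c`.
    have hdense : Dense ({0}ᶜ : Set (EuclideanSpace ℝ (Fin d))) := dense_compl_singleton 0
    have hxcl : x ∈ closure (interior B) := hBcl ▸ subset_closure hx
    obtain ⟨y, hyc, hyB⟩ := mem_closure_iff.1 hxcl _ hopen (by exact_mod_cast hxc)
    obtain ⟨x₀, ⟨hx₀c, hx₀B⟩, hx₀⟩ := hdense.inter_open_nonempty _ (hopen.inter isOpen_interior)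
      ⟨y, hyc, hyB⟩
    have hx₀0 : x₀ ≠ 0 := hx₀
    obtain ⟨δ, hδ, hball⟩ := Metric.isOpen_iff.1 isOpen_interior x₀ hx₀B
    have hlx : l ‖x₀‖ < c := by rw [← rateFunction_eq hl hx₀0]; exact hx₀c
    filter_upwards [exp_le_measureReal_randomWalk hR hU hl hl0 hindep hident hx₀0 hδ hlx, hpos,
      eventually_gt_atTop 0] with n h1 h2 hn0
    have hn0' : (0 : ℝ) < n := by exact_mod_cast hn0
    have hzc : z < ((-c : ℝ) : EReal) := by
      rw [EReal.coe_neg]; exact EReal.lt_neg_comm.1 hcz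
    refine hzc.trans_le (le_log_div_of_le_measureReal h2 (h1.trans (measureReal_mono ?_)))
    intro ω hω
    rw [Set.mem_ofPred_eq, Set.mem_smul_set_iff_inv_smul_mem₀ hn0'.ne']
    refine interior_subset (hball ?_)
    rw [Metric.mem_ball, dist_eq_norm]
    have e1 : (n : ℝ)⁻¹ • randomWalk X n ω - x₀ =
        (n : ℝ)⁻¹ • (randomWalk X n ω - (n : ℝ) • x₀) := by
      rw [smul_sub, smul_smul, inv_mul_cancel₀ hn0'.ne', one_smul]
    rw [e1, norm_smul, norm_inv, RCLike.norm_natCast, ← div_eq_inv_mul, div_lt_iff₀ hn0']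
    exact hω
  · rcases B.eq_empty_or_nonempty with rfl | hne
    · have hz0 : ⊥ < z := by simpa [hm] using hz
      filter_upwards [hpos] with n hn
      rw [EReal.div_lt_iff (by exact_mod_cast hn) (EReal.coe_ne_top _)]
      simp only [Set.smul_set_empty, Set.mem_empty_iff_false, Set.ofPred_false, measure_empty,
        ENNReal.log_zero]
      rw [bot_lt_iff_ne_bot] at hz0 ⊢
      induction z with
      | bot => exact absurd rfl hz0
      | coe z => rw [← EReal.coe_mul]; exact EReal.coe_ne_bot _
      | top => rw [EReal.top_mul_coe_of_pos hn]; simp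
    -- A point of the closure nearest to the origin: `B` avoids the open ball of radius `‖x‖`, and
    -- continuity of the rate function on the closure gives `m ≤ I(x)`.
    obtain ⟨x, hxB, hxd⟩ := isClosed_closure.exists_infDist_eq_dist hne.closure
      (0 : EuclideanSpace ℝ (Fin d))
    rw [Metric.infDist_closure, dist_zero_left] at hxd
    have hxmin : ∀ y ∈ B, ‖x‖ ≤ ‖y‖ := fun y hy => by
      rw [← hxd, ← dist_zero_left y]; exact Metric.infDist_le_dist_of_mem hy
    have hmx : m ≤ ((rateFunction h x : ℝ) : EReal) := by
      have hcl : IsClosed {y : EuclideanSpace ℝ (Fin d) | m ≤ ((rateFunction h y : ℝ) : EReal)} :=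
        isClosed_le continuous_const (continuous_coe_real_ereal.comp hcont)
      exact hcl.closure_subset_iff.2 (fun y hy => Set.mem_ofPred_eq ▸ (iInf₂_le y hy : m ≤ _)) hxB
    have hzx : -z < ((rateFunction h x : ℝ) : EReal) := (EReal.neg_lt_comm.1 hz).trans_le hmx
    obtain ⟨c, hzc, hcx⟩ := EReal.lt_iff_exists_real_btwn.1 hzx
    have hcx' : c < rateFunction h x := by exact_mod_cast hcx
    have hzc' : ((-c : ℝ) : EReal) < z := by
      rw [EReal.coe_neg]; exact EReal.neg_lt_comm.1 hzc
    have hbound : ∀ᶠ n : ℕ in atTop,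
        P.real {ω | ‖x‖ * n ≤ ‖randomWalk X n ω‖} ≤ Real.exp (-(c * h n)) := by
      -- At `x = 0` the number `c` is negative, so the bound exceeds `1` and is trivial.
      rcases eq_or_ne x 0 with rfl | hx0
      · rw [rateFunction_zero] at hcx'
        filter_upwards [hpos] with n hn
        exact measureReal_le_one.trans (Real.one_le_exp (by nlinarith))
      · have hxp := norm_pos_iff.2 hx0
        rw [rateFunction_eq hl hx0] at hcx'
        exact measureReal_le_norm_randomWalk_le hR hU hl hindep hident hxp (hlc _ hxp) hcx'
    filter_upwards [hbound, hpos, eventually_gt_atTop 0] with n h1 h2 hn0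
    have hn0' : (0 : ℝ) < n := by exact_mod_cast hn0
    refine (log_div_le_of_measureReal_le h2 ((measureReal_mono ?_).trans h1)).trans_lt hzc'
    intro ω hω
    rw [Set.mem_ofPred_eq, Set.mem_smul_set_iff_inv_smul_mem₀ hn0'.ne'] at hω
    have e1 := hxmin _ hω
    rw [norm_smul, norm_inv, RCLike.norm_natCast, ← div_eq_inv_mul, le_div_iff₀ hn0'] at e1
    exact e1
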